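/- Let $\mathfrak H$ be an infinite dimensional complex Hilbert space (separability is not needed) and let $\rho$ be a density operator on $\mathfrak H$, i.e. a positive operator with $\mathrm{tr}\,\rho=1$. For $n\ge 1$ let $\mathcal H_n=\mathfrak H\otimes\cdots\otimes\mathfrak H$ ($n$ factors) be the Hilbert space tensor product and $\mathcal P(\mathcal H_n)$ the set of all (orthogonal) projection operators on $\mathcal H_n$. A homogeneous $n$-time history is a finite sequence $h=(h_1,\dots,h_n)$ of projections on $\mathfrak H$; it is identified with the projection $h_1\otimes\cdots\otimes h_n\in\mathcal P(\mathcal H_n)$. The standard decoherence functional is defined on homogeneous histories (in the Heisenberg picture) by $$d_\rho(h,k)=\mathrm{tr}\,(h_n h_{n-1}\cdots h_1\,\rho\,k_1\cdots k_{n-1}k_n).$$ (a) For every $n\ge 2$ there is no finitely valued, countably additive extension of $d_\rho$ to all projections: there is no function $D:\mathcal P(\mathcal H_n)\times\mathcal P(\mathcal H_n)\to\mathbb C$ such that $D(h_1\otimes\cdots\otimes h_n,\,k_1\otimes\cdots\otimes k_n)=d_\rho(h,k)$ for all homogeneous histories $h,k$ and such that $D(\sum_i p_i,q)=\sum_i D(p_i,q)$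 (with convergent series) for every sequence $(p_i)_{i\in\mathbb N}$ of pairwise orthogonal projections on $\mathcal H_n$ and every $q\in\mathcal P(\mathcal H_n)$. (b) Let $(\psi_i)_{i\in I}$ be any orthonormal basis of $\mathfrak H$ consisting of eigenvectors of $\rho$, $\rho\psi_i=\omega_i\psi_i$, and consider the two-time Isham-Linden-Schreckenberg series $$D_\rho(p,q)=\sum_{j_1,j_2,j_3,j_4\in I}\omega_{j_1}\bigl\langle \psi_{j_4}\otimes\psi_{j_3}\otimes\psi_{j_1}\otimes\psi_{j_2},\,(p\otimes q)(\psi_{j_1}\otimes\psi_{j_4}\otimes\psi_{j_2}\otimes\psi_{j_3})\bigr\rangle,\qquad p,q\in\mathcal P(\mathfrak H\otimes\mathfrak H).$$ Fix $i_1\in I$ with $\omega_{i_1}\neq 0$ and put $\varphi_i=\frac1{\sqrt2}(\psi_i\otimes\psi_{i_1}+\psi_{i_1}\otimes\psi_i)$ for $i\ne i_1$. Then $\varphi_i\perp\varphi_j$ for $i\ne j$, and, with $P$ the projection onto the closed linear span of $\{\varphi_i: i\neq i_1\}$, there is a projection $q$ on $\mathfrak H\otimes\mathfrak H$ for which the series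 for $D_\rho(P,q)$ diverges; more precisely, the real parts of its partial sums over finite sets of indices $(j_1,j_2,j_3,j_4)$ tend to $+\infty$ along the directed set of all finite index sets. -/

import Mathlib

namespace HistoryQM

noncomputable section

open scoped ComplexOrder

/-! ### The `n`-fold Hilbert tensor product -/

/-- The algebraic `n`-fold tensor product of `H` by itself. It is a type of its own because it is
going to carry the Hilbert space inner product. -/
def AlgTensor (H : Type*) [NormedAddCommGroup H] [InnerProductSpace ℂ H] (n : ℕ) : Type _ :=
  PiTensorProduct ℂ (fun _ : Fin n => H)

section Construction

variable {H : Type*} [NormedAddCommGroup H] [InnerProductSpace ℂ H] {n : ℕ}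

instance : AddCommGroup (AlgTensor H n) :=
  inferInstanceAs (AddCommGroup (PiTensorProduct ℂ (fun _ : Fin n => H)))

instance : Module ℂ (AlgTensor H n) :=
  inferInstanceAs (Module ℂ (PiTensorProduct ℂ (fun _ : Fin n => H)))

/-- The algebraic pure tensor `x₁ ⊗ ⋯ ⊗ xₙ`. -/
def algTprod : MultilinearMap ℂ (fun _ : Fin n => H) (AlgTensor H n) :=
  PiTensorProduct.tprod ℂ

/-- Linear extension of a multilinear map. -/
def algLift {E : Type*} [AddCommGroup E] [Module ℂ E]
    (f : MultilinearMap ℂ (fun _ : Fin n => H) E) : AlgTensor H n →ₗ[ℂ] E :=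
  PiTensorProduct.lift f

@[simp] theorem algLift_tprod {E : Type*} [AddCommGroup E] [Module ℂ E]
    (f : MultilinearMap ℂ (fun _ : Fin n => H) E) (x : Fin n → H) :
    algLift f (algTprod x) = f x :=
  PiTensorProduct.lift.tprod x

theorem algTensor_induction {motive : AlgTensor H n → Prop} (z : AlgTensor H n)
    (tp : ∀ (c : ℂ) (x : Fin n → H), motive (c • algTprod x))
    (add : ∀ a b, motive a → motive b → motive (a + b)) : motive z :=
  PiTensorProduct.induction_on (motive := motive) z tp add

/-- The linear functional `y₁ ⊗ ⋯ ⊗ yₙ ↦ ∏ i, ⟪xᵢ, yᵢ⟫`. -/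
def pairing (x : Fin n → H) : AlgTensor H n →ₗ[ℂ] ℂ :=
  algLift ((MultilinearMap.mkPiAlgebra ℂ (Fin n) ℂ).compLinearMap
    (fun i => (innerₛₗ ℂ (x i) : H →ₗ[ℂ] ℂ)))

@[simp] theorem pairing_tprod (x y : Fin n → H) :
    pairing x (algTprod y) = ∏ i, inner ℂ (x i) (y i) := by
  simp [pairing]

theorem pairing_update_add (x : Fin n → H) (i : Fin n) (u v : H) (b : AlgTensor H n) :
    pairing (Function.update x i (u + v)) b
      = pairing (Function.update x i u) b + pairing (Function.update x i v) b := by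
  induction b using algTensor_induction with
  | tp c y =>
    have h : ∀ w : H, ∏ j, inner ℂ (Function.update x i w j) (y j)
        = inner ℂ w (y i) * ∏ j ∈ Finset.univ.erase i, inner ℂ (x j) (y j) := by
      intro w
      rw [← Finset.mul_prod_erase Finset.univ _ (Finset.mem_univ i)]
      congr 1
      · simp
      · refine Finset.prod_congr rfl fun j hj => ?_
        rw [Function.update_of_ne (Finset.ne_of_mem_erase hj)]
    simp only [map_smul, pairing_tprod, h, inner_add_left, smul_eq_mul]
    ring
  | add a b ha hb =>
    simp only [map_add, ha, hb]
    ring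

theorem pairing_update_smul (x : Fin n → H) (i : Fin n) (c : ℂ) (u : H) (b : AlgTensor H n) :
    pairing (Function.update x i (c • u)) b
      = (starRingEnd ℂ) c * pairing (Function.update x i u) b := by
  induction b using algTensor_induction with
  | tp d y =>
    have h : ∀ w : H, ∏ j, inner ℂ (Function.update x i w j) (y j)
        = inner ℂ w (y i) * ∏ j ∈ Finset.univ.erase i, inner ℂ (x j) (y j) := by
      intro w
      rw [← Finset.mul_prod_erase Finset.univ _ (Finset.mem_univ i)]
      congr 1
      · simp
      · refine Finset.prod_congr rfl fun j hj => ?_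
        rw [Function.update_of_ne (Finset.ne_of_mem_erase hj)]
    simp only [map_smul, pairing_tprod, h, inner_smul_left, smul_eq_mul]
    ring
  | add a b ha hb =>
    simp only [map_add, ha, hb]
    ring

/-- For fixed `b`, the multilinear map `x ↦ conj ⟪x₁ ⊗ ⋯ ⊗ xₙ, b⟫`. -/
def conjPairing (b : AlgTensor H n) : MultilinearMap ℂ (fun _ : Fin n => H) ℂ where
  toFun x := (starRingEnd ℂ) (pairing x b)
  map_update_add' := by
    intro inst x i u v
    rw [Subsingleton.elim inst (instDecidableEqFin n), pairing_update_add, map_add]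
  map_update_smul' := by
    intro inst x i c u
    rw [Subsingleton.elim inst (instDecidableEqFin n), pairing_update_smul]
    simp

/-- The inner product on the algebraic tensor product, conjugate linear in the first variable. -/
instance : Inner ℂ (AlgTensor H n) :=
  ⟨fun a b => (starRingEnd ℂ) (algLift (conjPairing b) a)⟩

theorem algInner_tprod_left (x : Fin n → H) (b : AlgTensor H n) :
    inner ℂ (algTprod x) b = pairing x b := by
  change (starRingEnd ℂ) (algLift (conjPairing b) (algTprod x)) = _
  rw [algLift_tprod]
  simp [conjPairing]

theorem algInner_add_left (a b c : AlgTensor H n) :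
    inner ℂ (a + b) c = inner ℂ a c + inner ℂ b c := by
  change (starRingEnd ℂ) (algLift (conjPairing c) (a + b)) = _
  rw [map_add, map_add]
  rfl

theorem algInner_smul_left (r : ℂ) (a c : AlgTensor H n) :
    inner ℂ (r • a) c = (starRingEnd ℂ) r * inner ℂ a c := by
  change (starRingEnd ℂ) (algLift (conjPairing c) (r • a)) = _
  rw [map_smul, smul_eq_mul, map_mul]
  rfl

theorem algInner_add_right (a b c : AlgTensor H n) :
    inner ℂ a (b + c) = inner ℂ a b + inner ℂ a c := by
  induction a using algTensor_induction with
  | tp d x => simp only [algInner_smul_left, algInner_tprod_left, map_add, mul_add]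
  | add a a' ha ha' => simp only [algInner_add_left, ha, ha']; ring

theorem algInner_smul_right (r : ℂ) (a c : AlgTensor H n) :
    inner ℂ a (r • c) = r * inner ℂ a c := by
  induction a using algTensor_induction with
  | tp d x =>
    simp only [algInner_smul_left, algInner_tprod_left, map_smul, smul_eq_mul]
    ring
  | add a a' ha ha' => simp only [algInner_add_left, ha, ha']; ring

theorem algInner_conj_symm (a b : AlgTensor H n) :
    (starRingEnd ℂ) (inner ℂ b a) = inner ℂ a b := by
  induction a using algTensor_induction with
  | tp c x =>
    induction b using algTensor_induction with
    | tp d y =>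
      simp only [algInner_smul_left, algInner_smul_right, algInner_tprod_left, pairing_tprod,
        map_mul, map_prod, inner_conj_symm, Complex.conj_conj]
      ring
    | add b b' hb hb' => simp only [algInner_add_left, algInner_add_right, map_add, hb, hb']
  | add a a' ha ha' => simp only [algInner_add_left, algInner_add_right, map_add, ha, ha']

theorem algTensor_exists_sum (a : AlgTensor H n) :
    ∃ (m : ℕ) (c : Fin m → ℂ) (x : Fin m → Fin n → H), a = ∑ k, c k • algTprod (x k) := by
  induction a using algTensor_induction with
  | tp c x => exact ⟨1, fun _ => c, fun _ => x, by simp⟩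
  | add a b ha hb =>
    obtain ⟨m, c, x, rfl⟩ := ha
    obtain ⟨m', c', x', rfl⟩ := hb
    exact ⟨m + m', Fin.append c c', Fin.append x x', by simp [Fin.sum_univ_add]⟩

theorem posSemidef_prod_gram {m : ℕ} (x : Fin m → Fin n → H) (s : Finset (Fin n)) :
    (Matrix.of fun j k : Fin m => ∏ i ∈ s, inner ℂ (x j i) (x k i)).PosSemidef := by
  classical
  induction s using Finset.induction_on with
  | empty =>
    have e : (Matrix.of fun j k : Fin m => ∏ i ∈ (∅ : Finset (Fin n)), inner ℂ (x j i) (x k i))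
        = Matrix.gram ℂ (fun _ : Fin m => (1 : ℂ)) := by
      ext j k
      simp [Matrix.gram]
    rw [e]
    exact Matrix.posSemidef_gram ℂ _
  | insert i s hi ih =>
    have e : (Matrix.of fun j k : Fin m => ∏ i ∈ insert i s, inner ℂ (x j i) (x k i))
        = (Matrix.gram ℂ (fun j : Fin m => x j i)).hadamard
          (Matrix.of fun j k : Fin m => ∏ i ∈ s, inner ℂ (x j i) (x k i)) := by
      ext j k
      simp [Matrix.gram, Finset.prod_insert hi]
    rw [e]
    exact (Matrix.posSemidef_gram ℂ _).hadamard ih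

theorem algInner_self_nonneg (a : AlgTensor H n) : 0 ≤ Complex.re (inner ℂ a a) := by
  obtain ⟨m, c, x, rfl⟩ := algTensor_exists_sum a
  have hL : ∀ (b : AlgTensor H n), inner ℂ (∑ k, c k • algTprod (x k)) b
      = ∑ k, (starRingEnd ℂ) (c k) * pairing (x k) b := by
    intro b
    change (starRingEnd ℂ) (algLift (conjPairing b) _) = _
    simp [conjPairing, map_sum]
  have h := (posSemidef_prod_gram x Finset.univ).dotProduct_mulVec_nonneg c
  have h2 : inner ℂ (∑ k, c k • algTprod (x k)) (∑ k, c k • algTprod (x k))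
      = star c ⬝ᵥ (Matrix.of fun j k : Fin m =>
          ∏ i ∈ Finset.univ, inner ℂ (x j i) (x k i)).mulVec c := by
    rw [hL]
    simp only [dotProduct, Matrix.mulVec, Matrix.of_apply, map_sum, map_smul, pairing_tprod,
      smul_eq_mul, Pi.star_apply, RCLike.star_def]
    refine Finset.sum_congr rfl fun j _ => ?_
    congr 1
    exact Finset.sum_congr rfl fun k _ => mul_comm _ _
  rw [h2]
  exact (Complex.le_def.1 h).1

instance algCore : PreInnerProductSpace.Core ℂ (AlgTensor H n) where
  conj_inner_symm := algInner_conj_symm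
  re_inner_nonneg := algInner_self_nonneg
  add_left := algInner_add_left
  smul_left a c r := algInner_smul_left r a c

instance : SeminormedAddCommGroup (AlgTensor H n) :=
  InnerProductSpace.Core.toSeminormedAddCommGroup (𝕜 := ℂ)

instance : InnerProductSpace ℂ (AlgTensor H n) := .ofCore _

end Construction

/-- The `n`-time history Hilbert space `H ⊗ ⋯ ⊗ H` (`n` factors): the Hilbert space completion of
the algebraic tensor product for the inner product
`⟪x₁ ⊗ ⋯ ⊗ xₙ, y₁ ⊗ ⋯ ⊗ yₙ⟫ = ∏ i, ⟪xᵢ, yᵢ⟫`. -/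
abbrev HistorySpace (H : Type*) [NormedAddCommGroup H] [InnerProductSpace ℂ H] (n : ℕ) : Type _ :=
  UniformSpace.Completion (AlgTensor H n)

/-- The set of projection operators on a Hilbert space. -/
abbrev Proj (K : Type*) [NormedAddCommGroup K] [InnerProductSpace ℂ K] [CompleteSpace K] : Type _ :=
  {p : K →L[ℂ] K // IsStarProjection p}

section Homogeneous

variable {H : Type*} [NormedAddCommGroup H] [InnerProductSpace ℂ H] {n : ℕ}

/-- The pure tensor `x₁ ⊗ ⋯ ⊗ xₙ` in the history Hilbert space. -/
def tprod (x : Fin n → H) : HistorySpace H n := ((algTprod x : AlgTensor H n) : HistorySpace H n)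

theorem inner_tprod (x y : Fin n → H) :
    inner ℂ (tprod x) (tprod y) = ∏ i, inner ℂ (x i) (y i) := by
  rw [tprod, tprod, UniformSpace.Completion.inner_coe, algInner_tprod_left, pairing_tprod]

/-- `h₁ ⊗ ⋯ ⊗ hₙ` on the algebraic tensor product. -/
def algMap (h : Fin n → H →ₗ[ℂ] H) : AlgTensor H n →ₗ[ℂ] AlgTensor H n :=
  algLift (algTprod.compLinearMap h)

@[simp] theorem algMap_tprod (h : Fin n → H →ₗ[ℂ] H) (x : Fin n → H) :
    algMap h (algTprod x) = algTprod fun i => h i (x i) := by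
  simp [algMap]

variable [CompleteSpace H]

/-- `h₁ ⊗ ⋯ ⊗ hₙ` on the algebraic tensor product, for projections `hᵢ`. -/
def algProj (h : Fin n → Proj H) : AlgTensor H n →ₗ[ℂ] AlgTensor H n :=
  algMap fun i => ((h i : H →L[ℂ] H) : H →ₗ[ℂ] H)

theorem proj_idem {K : Type*} [NormedAddCommGroup K] [InnerProductSpace ℂ K] [CompleteSpace K]
    (p : Proj K) (x : K) : (p : K →L[ℂ] K) ((p : K →L[ℂ] K) x) = (p : K →L[ℂ] K) x :=
  congrArg (fun f : K →L[ℂ] K => f x) p.2.isIdempotentElem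

theorem proj_symm {K : Type*} [NormedAddCommGroup K] [InnerProductSpace ℂ K] [CompleteSpace K]
    (p : Proj K) (x y : K) :
    inner ℂ ((p : K →L[ℂ] K) x) y = inner ℂ x ((p : K →L[ℂ] K) y) :=
  (ContinuousLinearMap.isSelfAdjoint_iff_isSymmetric.1 p.2.isSelfAdjoint) x y

theorem algProj_idem (h : Fin n → Proj H) (a : AlgTensor H n) :
    algProj h (algProj h a) = algProj h a := by
  induction a using algTensor_induction with
  | tp c x => simp [algProj, proj_idem]
  | add a b ha hb => simp only [map_add, ha, hb]

theorem algProj_symm (h : Fin n → Proj H) (a b : AlgTensor H n) :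
    inner ℂ (algProj h a) b = inner ℂ a (algProj h b) := by
  induction a using algTensor_induction with
  | tp c x =>
    induction b using algTensor_induction with
    | tp d y =>
      simp only [algProj, map_smul, algMap_tprod, algInner_smul_left, algInner_smul_right,
        algInner_tprod_left, pairing_tprod, ContinuousLinearMap.coe_coe, proj_symm]
    | add b b' hb hb' => simp only [map_add, algInner_add_right, hb, hb']
  | add a a' ha ha' => simp only [map_add, algInner_add_left, ha, ha']

theorem algProj_norm_le (h : Fin n → Proj H) (a : AlgTensor H n) :
    ‖algProj h a‖ ≤ 1 * ‖a‖ := by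
  have h1 : ‖algProj h a‖ ^ 2 ≤ ‖a‖ * ‖algProj h a‖ := by
    rw [← inner_self_eq_norm_sq (𝕜 := ℂ), algProj_symm, algProj_idem]
    exact (re_inner_le_norm (𝕜 := ℂ) a (algProj h a))
  rw [one_mul]
  by_contra hlt
  push Not at hlt
  nlinarith [norm_nonneg a]

/-- The bounded operator `h₁ ⊗ ⋯ ⊗ hₙ` on the history Hilbert space. -/
def tensorOp (h : Fin n → Proj H) : HistorySpace H n →L[ℂ] HistorySpace H n :=
  ((algProj h).mkContinuous 1 (algProj_norm_le h)).completion

theorem tensorOp_coe (h : Fin n → Proj H) (a : AlgTensor H n) :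
    tensorOp h (a : HistorySpace H n) = ((algProj h a : AlgTensor H n) : HistorySpace H n) := by
  simp [tensorOp, ContinuousLinearMap.completion_apply_coe]

theorem tensorOp_isStarProjection (h : Fin n → Proj H) : IsStarProjection (tensorOp h) where
  isIdempotentElem := by
    refine ContinuousLinearMap.ext fun x => ?_
    change tensorOp h (tensorOp h x) = tensorOp h x
    induction x using UniformSpace.Completion.induction_on with
    | hp => exact isClosed_eq (by fun_prop) (by fun_prop)
    | ih a => simp only [tensorOp_coe, algProj_idem]
  isSelfAdjoint := by
    refine ContinuousLinearMap.isSelfAdjoint_iff_isSymmetric.2 fun x y => ?_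
    change inner ℂ (tensorOp h x) y = inner ℂ x (tensorOp h y)
    induction x, y using UniformSpace.Completion.induction_on₂ with
    | hp => exact isClosed_eq (by fun_prop) (by fun_prop)
    | ih a b =>
      simp only [tensorOp_coe, UniformSpace.Completion.inner_coe, algProj_symm]

/-- The projection `h₁ ⊗ ⋯ ⊗ hₙ` on the history Hilbert space that represents the homogeneous
history `(h₁, …, hₙ)`. -/
def homogeneous (h : Fin n → Proj H) : Proj (HistorySpace H n) :=
  ⟨tensorOp h, tensorOp_isStarProjection h⟩

theorem homogeneous_tprod (h : Fin n → Proj H) (x : Fin n → H) :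
    (homogeneous h : HistorySpace H n →L[ℂ] HistorySpace H n) (tprod x)
      = tprod fun i => (h i : H →L[ℂ] H) (x i) := by
  simp [homogeneous, tprod, tensorOp_coe, algProj]

end Homogeneous

/-! ### States, traces and the standard decoherence functional -/

section Decoherence

variable {H : Type*} [NormedAddCommGroup H] [InnerProductSpace ℂ H] [CompleteSpace H]

/-- Index set of an orthonormal basis of `H`, chosen once and for all. -/
def stdIndex (H : Type*) [NormedAddCommGroup H] [InnerProductSpace ℂ H] [CompleteSpace H] : Set H :=
  (exists_hilbertBasis ℂ H).choose

/-- An orthonormal basis of `H`, chosen once and for all. -/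
def stdBasis (H : Type*) [NormedAddCommGroup H] [InnerProductSpace ℂ H] [CompleteSpace H] :
    HilbertBasis (stdIndex H) ℂ H :=
  (exists_hilbertBasis ℂ H).choose_spec.choose

/-- The trace `∑ᵢ ⟪bᵢ, A bᵢ⟫` of a trace class operator. (For trace class operators, the only ones
to which it is applied, the series converges absolutely and its sum does not depend on the
orthonormal basis.) -/
def trace (A : H →L[ℂ] H) : ℂ := ∑' i, inner ℂ (stdBasis H i) (A (stdBasis H i))

/-- Density operators: positive operators of trace one. -/
structure IsDensityOperator (ρ : H →L[ℂ] H) : Prop where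
  isPositive : ρ.IsPositive
  hasSum_one : HasSum (fun i => inner ℂ (stdBasis H i) (ρ (stdBasis H i))) 1

/-- The standard decoherence functional on homogeneous histories,
`d_ρ(h, k) = tr (hₙ ⋯ h₁ ρ k₁ ⋯ kₙ)`, in the Heisenberg picture. -/
def stdDecoherence (ρ : H →L[ℂ] H) {n : ℕ} (h k : Fin n → Proj H) : ℂ :=
  trace ((List.ofFn fun i => (h i : H →L[ℂ] H)).reverse.prod * ρ *
    (List.ofFn fun i => (k i : H →L[ℂ] H)).prod)

/-- `P` is the sum of the pairwise orthogonal sequence of projections `p`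
(in the strong operator topology). -/
structure IsOrthogonalSum {K : Type*} [NormedAddCommGroup K] [InnerProductSpace ℂ K]
    [CompleteSpace K] (p : ℕ → Proj K) (P : Proj K) : Prop where
  orthogonal : Pairwise fun i j => (p i : K →L[ℂ] K) * (p j : K →L[ℂ] K) = 0
  hasSum : ∀ x : K, HasSum (fun i => (p i : K →L[ℂ] K) x) ((P : K →L[ℂ] K) x)

/-- A complex valued functional `D` of pairs of projections is countably additive (in its first
argument) if `D(∑ᵢ pᵢ, q) = ∑ᵢ D(pᵢ, q)` for all orthogonal sequences `p` and all `q`. -/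
def IsCountablyAdditive {K : Type*} [NormedAddCommGroup K] [InnerProductSpace ℂ K]
    [CompleteSpace K] (D : Proj K → Proj K → ℂ) : Prop :=
  ∀ (p : ℕ → Proj K) (P q : Proj K), IsOrthogonalSum p P → HasSum (fun i => D (p i) q) (D P q)

/-- `D` agrees with `d_ρ` on all pairs of homogeneous `n`-time histories. -/
def ExtendsStd (ρ : H →L[ℂ] H) {n : ℕ}
    (D : Proj (HistorySpace H n) → Proj (HistorySpace H n) → ℂ) : Prop :=
  ∀ h k : Fin n → Proj H, D (homogeneous h) (homogeneous k) = stdDecoherence ρ h k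

/-! ### The two-time Isham-Linden-Schreckenberg series -/

/-- The term with index `(j₁, j₂, j₃, j₄)` of the series
`∑ ω_{j₁} ⟪e⁴_{j₄} ⊗ e³_{j₃} ⊗ ψ_{j₁} ⊗ e²_{j₂}, (p ⊗ q) (ψ_{j₁} ⊗ e⁴_{j₄} ⊗ e²_{j₂} ⊗ e³_{j₃})⟫`.
The inner product in the fourfold tensor product is written out as the product of the inner
products in the first two and the last two factors. -/
def ilsTerm {ι : Type*} (ω : ι → ℝ) (ψ e2 e3 e4 : ι → H) (p q : Proj (HistorySpace H 2))
    (j : ι × ι × ι × ι) : ℂ :=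
  (ω j.1 : ℂ) *
    (inner ℂ (tprod ![e4 j.2.2.2, e3 j.2.2.1])
        ((p : HistorySpace H 2 →L[ℂ] HistorySpace H 2) (tprod ![ψ j.1, e4 j.2.2.2])) *
      inner ℂ (tprod ![ψ j.1, e2 j.2.1])
        ((q : HistorySpace H 2 →L[ℂ] HistorySpace H 2) (tprod ![e2 j.2.1, e3 j.2.2.1])))

/-- `φ_i = (ψ_i ⊗ ψ_{i₁} + ψ_{i₁} ⊗ ψ_i) / √2`. -/
def symVec {ι : Type*} (ψ : ι → H) (i₁ i : ι) : HistorySpace H 2 :=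
  ((Real.sqrt 2 : ℂ))⁻¹ • (tprod ![ψ i, ψ i₁] + tprod ![ψ i₁, ψ i])

/-- The orthogonal projection onto the closed linear span of a set of vectors. -/
def projSpan {K : Type*} [NormedAddCommGroup K] [InnerProductSpace ℂ K] [CompleteSpace K]
    (S : Set K) : Proj K :=
  ⟨(Submodule.span ℂ S).topologicalClosure.starProjection, isStarProjection_starProjection⟩

end Decoherence

end

end HistoryQM

namespace HistoryQM

open Filter Topology

/-! ### Hilbert space geometry: moving vectors by unitaries, and a bisector estimate. -/

section Hilbert

variable {K : Type*} [NormedAddCommGroup K] [InnerProductSpace ℂ K]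

/-! For (a), fix the second history to be trivial and let the first test for a unit vector `x`, then
for a unit vector `b`, then for nothing. The functional takes the value `⟪b, x⟫ * ⟪ρ x, b⟫` there
(`stdDecoherence_twoStep`), and `b` can be chosen so that its modulus is at least `‖ρ x‖ / 2`
(`exists_unit_norm_le`). If `x` runs through an orthonormal sequence, these histories are orthogonal
already in the first time slot, whatever the `b i` are. They therefore have a sum, and countable
additivity forces `∑ ‖ρ (x i)‖ < ∞`. But `‖ρ (x i)‖ * ‖u‖` dominates `‖⟪x i, ρ u⟫‖`, and whenever `ρ
u ≠ 0` some orthonormal sequence makes the latter non-summable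
(`exists_orthonormal_not_summable_inner`): a nonzero vector has square-summable coefficients, but
they need not be summable. Of the trace condition only `ρ ≠ 0` is needed.

For (b), take for `q` the projection onto the line of `ψ i₁ ⊗ ψ i₁`. It pins `j₁ = j₂ = j₃ = i₁` and
leaves `j₄` free. The projection onto the span of the `φ i` acts on `ψ i₁ ⊗ ψ i` as symmetrization
for `i ≠ i₁`, so each such `j₄` contributes the same positive number `ω i₁ / 2` and every other term
vanishes (`ilsTerm_symVec`). -/

theorem infinite_of_hilbertBasis (hK : ¬ FiniteDimensional ℂ K) {ι : Type*}
    (b : HilbertBasis ι ℂ K) : Infinite ι := by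
  refine not_finite_iff_infinite.1 fun hfin => hK ?_
  have hfd : FiniteDimensional ℂ (Submodule.span ℂ (Set.range b)) :=
    FiniteDimensional.span_of_finite ℂ (Set.finite_range b)
  have h := b.dense_span
  rw [(Submodule.closed_of_finiteDimensional (Submodule.span ℂ
    (Set.range b))).submodule_topologicalClosure_eq] at h
  rw [h] at hfd
  exact Module.finite_def.2 (Module.Finite.iff_fg.1 hfd)

/-- Two vectors of equal norm and with real inner product are exchanged by a reflection. -/
theorem exists_linearIsometryEquiv_apply_eq {v w : K} (hn : ‖v‖ = ‖w‖)
    (hr : inner ℂ v w = inner ℂ w v) : ∃ U : K ≃ₗᵢ[ℂ] K, U w = v := by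
  -- Reflecting in the hyperplane orthogonal to `w - v` fixes `w + v`, because equal norms and a
  -- real inner product make the two orthogonal.
  let L : Submodule ℂ K := (Submodule.span ℂ {w - v})ᗮ
  refine ⟨L.reflection, ?_⟩
  have h1 : w + v ∈ L := by
    refine Submodule.mem_orthogonal_singleton_iff_inner_right.2 ?_
    rw [inner_sub_left, inner_add_right, inner_add_right, inner_self_eq_norm_sq_to_K,
      inner_self_eq_norm_sq_to_K, hn, hr]
    ring
  have h2 : w - v ∈ Lᗮ :=
    Submodule.le_orthogonal_orthogonal _ (Submodule.mem_span_singleton_self _)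
  have h3 : w = (2⁻¹ : ℂ) • (w + v) + (2⁻¹ : ℂ) • (w - v) := by module
  calc L.reflection w = L.reflection ((2⁻¹ : ℂ) • (w + v) + (2⁻¹ : ℂ) • (w - v)) :=
        congrArg L.reflection h3
    _ = (2⁻¹ : ℂ) • L.reflection (w + v) + (2⁻¹ : ℂ) • L.reflection (w - v) := by
        simp only [map_add, map_smul]
    _ = v := by
        rw [Submodule.reflection_mem_subspace_eq_self h1,
          Submodule.reflection_mem_subspace_orthogonalComplement_eq_neg h2]
        module

/-- Rescaling `v` by a positive factor equalizes the norms and a phase makes the inner product real,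
so the reflection lemma applies. -/
theorem exists_linearIsometryEquiv_apply_eq_smul {v w : K} (hv : v ≠ 0) (hw : w ≠ 0) :
    ∃ (U : K ≃ₗᵢ[ℂ] K) (c : ℂ), c ≠ 0 ∧ U w = c • v := by
  obtain ⟨a, ha, har⟩ : ∃ a : ℂ, ‖a‖ = 1 ∧ (starRingEnd ℂ) (a * inner ℂ w v) = a * inner ℂ w v := by
    by_cases h : inner ℂ w v = 0
    · exact ⟨1, by simp, by simp [h]⟩
    · have h' : (‖inner ℂ w v‖ : ℂ) ≠ 0 := by simpa using h
      refine ⟨(starRingEnd ℂ) (inner ℂ w v) / ‖inner ℂ w v‖, ?_, ?_⟩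
      · rw [norm_div, RCLike.norm_conj, Complex.norm_real, norm_norm,
          div_self (norm_ne_zero_iff.2 h)]
      · simp only [map_mul, map_div₀, Complex.conj_conj, Complex.conj_ofReal]
        ring
  have hv' := norm_ne_zero_iff.2 hv
  have hw' := norm_ne_zero_iff.2 hw
  have hr0 : ((‖w‖ / ‖v‖ : ℝ) : ℂ) ≠ 0 := by
    exact_mod_cast div_ne_zero hw' hv'
  have ha0 : a ≠ 0 := by
    rintro rfl
    simp at ha
  obtain ⟨U, hU⟩ := exists_linearIsometryEquiv_apply_eq
    (v := (((‖w‖ / ‖v‖ : ℝ) : ℂ) * a) • v) (w := w) (by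
      rw [norm_smul, norm_mul, ha, Complex.norm_real, norm_div, norm_norm, norm_norm]
      field_simp) (by
      rw [← inner_conj_symm, inner_smul_right, mul_assoc, map_mul, har, Complex.conj_ofReal])
  exact ⟨U, _, mul_ne_zero hr0 ha0, hU⟩

/-- For a positive operator `ρ` and a unit vector `x`, some unit vector `b` makes
`⟪b, x⟫ * ⟪ρ x, b⟫` at least half as large as `‖ρ x‖`. -/
theorem exists_unit_norm_le {ρ : K →L[ℂ] K} (hρ : ρ.IsPositive) {x : K} (hx : ‖x‖ = 1) :
    ∃ b : K, ‖b‖ = 1 ∧ ‖ρ x‖ / 2 ≤ ‖inner ℂ b x * inner ℂ (ρ x) b‖ := by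
  by_cases h0 : ρ x = 0
  · exact ⟨x, hx, by simp [h0]⟩
  have hr : 0 < ‖ρ x‖ := norm_pos_iff.2 h0
  set r := ‖ρ x‖ with hrdef
  obtain ⟨t, ht0, ht⟩ : ∃ t : ℝ, 0 ≤ t ∧ inner ℂ (ρ x) x = (t : ℂ) := by
    have h := hρ.inner_nonneg_left x
    rw [Complex.le_def] at h
    exact ⟨_, h.1, Complex.ext (by simp) (by simpa using h.2.symm)⟩
  have ht' : inner ℂ x (ρ x) = (t : ℂ) := by rw [← inner_conj_symm, ht, Complex.conj_ofReal]
  have hself : inner ℂ (ρ x) (ρ x) = ((r ^ 2 : ℝ) : ℂ) := by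
    rw [inner_self_eq_norm_sq_to_K]; simp [r]
  have hxx : inner ℂ x x = (1 : ℂ) := by
    rw [inner_self_eq_norm_sq_to_K, hx]; simp
  -- The bisector of the directions of `x` and `ρ x`. With `t = ⟪ρ x, x⟫`, its normalization gives
  -- exactly `(r + t) / 2`, and positivity of `ρ` makes `t ≥ 0`.
  set z := (r : ℂ) • x + ρ x with hz
  have hzx : inner ℂ z x = ((r + t : ℝ) : ℂ) := by
    rw [hz, inner_add_left, inner_smul_left, hxx, ht, Complex.conj_ofReal]
    push_cast; ring
  have hρz : inner ℂ (ρ x) z = ((r * (r + t) : ℝ) : ℂ) := by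
    rw [hz, inner_add_right, inner_smul_right, ht, hself]
    push_cast; ring
  have hzz : ‖z‖ ^ 2 = 2 * r * (r + t) := by
    have h : inner ℂ z z = ((2 * r * (r + t) : ℝ) : ℂ) := by
      conv_lhs => rw [hz]
      rw [inner_add_left, inner_smul_left, Complex.conj_ofReal, hρz, ← inner_conj_symm, hzx,
        Complex.conj_ofReal]
      push_cast; ring
    rw [inner_self_eq_norm_sq_to_K, RCLike.ofReal_eq_complex_ofReal] at h
    exact_mod_cast h
  have hz0 : 0 < ‖z‖ := by
    have : 0 < ‖z‖ ^ 2 := by rw [hzz]; positivity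
    exact lt_of_le_of_ne (norm_nonneg z) fun h => by simp [← h] at this
  refine ⟨((‖z‖⁻¹ : ℝ) : ℂ) • z, ?_, ?_⟩
  · rw [norm_smul, Complex.norm_real, norm_inv, norm_norm, inv_mul_cancel₀ hz0.ne']
  · rw [inner_smul_left, inner_smul_right, Complex.conj_ofReal, hzx, hρz]
    norm_cast
    rw [Real.norm_of_nonneg (by positivity)]
    have : ‖z‖⁻¹ * (r + t) * (‖z‖⁻¹ * (r * (r + t))) = (r + t) / 2 := by
      have h2 : ‖z‖⁻¹ * (r + t) * (‖z‖⁻¹ * (r * (r + t))) = r * (r + t) ^ 2 / ‖z‖ ^ 2 := by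
        field_simp
      rw [h2, hzz]
      have : r + t ≠ 0 := by positivity
      field_simp
    rw [this]
    linarith

theorem eigenvalue_pos {ρ : K →L[ℂ] K} (hρ : ρ.IsPositive) {v : K} (hv : ‖v‖ = 1) {a : ℝ}
    (hva : ρ v = (a : ℂ) • v) (ha : a ≠ 0) : 0 < a := by
  refine lt_of_le_of_ne ?_ ha.symm
  have h := hρ.inner_nonneg_right v
  rw [hva, inner_smul_right, inner_self_eq_norm_sq_to_K, hv] at h
  simpa using h

/-! ### Projections onto closed spans and orthogonal sums of projections. -/

variable [CompleteSpace K]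

/-- Orthogonality to the generators passes to the closed span, so a projection can be computed by
guessing its value and testing the remainder on `S`. -/
theorem projSpan_apply_eq {S : Set K} {x y : K} (hy : y ∈ Submodule.span ℂ S)
    (h : ∀ s ∈ S, inner ℂ s (x - y) = 0) : (projSpan S : K →L[ℂ] K) x = y := by
  refine Submodule.eq_starProjection_of_mem_orthogonal (Submodule.le_topologicalClosure _ hy) ?_
  rw [Submodule.orthogonal_closure, Submodule.mem_orthogonal]
  intro u hu
  induction hu using Submodule.span_induction with
  | mem s hs => exact h s hs
  | zero => simp
  | add a b _ _ ha hb => rw [inner_add_left, ha, hb, add_zero]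
  | smul c a _ ha => rw [inner_smul_left, ha, mul_zero]

theorem projSpan_singleton_apply {v : K} (hv : ‖v‖ = 1) (x : K) :
    (projSpan {v} : K →L[ℂ] K) x = inner ℂ v x • v := by
  refine projSpan_apply_eq (Submodule.smul_mem _ _ (Submodule.mem_span_singleton_self v)) ?_
  rintro s rfl
  rw [inner_sub_right, inner_smul_right, inner_self_eq_norm_sq_to_K, hv]
  simp

theorem proj_inner_apply (p : Proj K) (x : K) :
    inner ℂ ((p : K →L[ℂ] K) x) x = ((‖(p : K →L[ℂ] K) x‖ ^ 2 : ℝ) : ℂ) := by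
  rw [← proj_idem, proj_symm, proj_idem, inner_self_eq_norm_sq_to_K]
  simp

/-- Every sequence of pairwise orthogonal projections has a sum. -/
theorem exists_isOrthogonalSum (p : ℕ → Proj K)
    (hp : Pairwise fun i j => (p i : K →L[ℂ] K) * (p j : K →L[ℂ] K) = 0) :
    ∃ P : Proj K, IsOrthogonalSum p P := by
  have hpp : ∀ i j, i ≠ j → ∀ x, (p i : K →L[ℂ] K) ((p j : K →L[ℂ] K) x) = 0 := fun i j hij x =>
    congrArg (fun f : K →L[ℂ] K => f x) (hp hij)
  have horth : ∀ i j, i ≠ j → ∀ x y, inner ℂ ((p i : K →L[ℂ] K) x) ((p j : K →L[ℂ] K) y) = 0 := by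
    intro i j hij x y
    rw [proj_symm, hpp i j hij, inner_zero_right]
  let V : ℕ → Submodule ℂ K := fun i => LinearMap.range (p i : K →L[ℂ] K).toLinearMap
  have hV : OrthogonalFamily ℂ (fun i => V i) fun i => (V i).subtypeₗᵢ := by
    rintro i j hij ⟨_, x, rfl⟩ ⟨_, y, rfl⟩
    exact horth i j hij x y
  -- Bessel's inequality for the ranges; it gives pointwise convergence of the series.
  have hnorm : ∀ (x : K) (s : Finset ℕ), ∑ i ∈ s, ‖(p i : K →L[ℂ] K) x‖ ^ 2 ≤ ‖x‖ ^ 2 := by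
    intro x s
    have h1 : ‖∑ i ∈ s, (p i : K →L[ℂ] K) x‖ ^ 2 = ∑ i ∈ s, ‖(p i : K →L[ℂ] K) x‖ ^ 2 :=
      hV.norm_sum (fun i => ⟨(p i : K →L[ℂ] K) x, x, rfl⟩) s
    have h2 : inner ℂ (∑ i ∈ s, (p i : K →L[ℂ] K) x) x
        = ((∑ i ∈ s, ‖(p i : K →L[ℂ] K) x‖ ^ 2 : ℝ) : ℂ) := by
      rw [sum_inner, Complex.ofReal_sum]
      exact Finset.sum_congr rfl fun i _ => proj_inner_apply (p i) x
    have h3 := re_inner_le_norm (𝕜 := ℂ) (∑ i ∈ s, (p i : K →L[ℂ] K) x) x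
    rw [h2, ← h1] at h3
    rw [← h1]
    have h4 : ‖∑ i ∈ s, (p i : K →L[ℂ] K) x‖ ^ 2 ≤ ‖∑ i ∈ s, (p i : K →L[ℂ] K) x‖ * ‖x‖ := by
      simpa only [RCLike.re_eq_complex_re, Complex.ofReal_re] using h3
    have h5 : ‖∑ i ∈ s, (p i : K →L[ℂ] K) x‖ ≤ ‖x‖ := by
      by_contra hlt
      push Not at hlt
      nlinarith [norm_nonneg x]
    exact pow_le_pow_left₀ (norm_nonneg _) h5 2
  have hsum : ∀ x : K, Summable fun i => (p i : K →L[ℂ] K) x := by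
    intro x
    refine (hV.summable_iff_norm_sq_summable fun i => ⟨(p i : K →L[ℂ] K) x, x, rfl⟩).2 ?_
    exact summable_of_sum_le (fun i => sq_nonneg _) (hnorm x)
  refine ⟨projSpan (⋃ i, Set.range (p i : K →L[ℂ] K)), hp, fun x => ?_⟩
  have hx := (hsum x).hasSum
  convert hx using 1
  refine Submodule.eq_starProjection_of_mem_orthogonal ?_ ?_
  · refine (Submodule.isClosed_topologicalClosure _).mem_of_tendsto hx
      (Eventually.of_forall fun s => Submodule.sum_mem _ fun i _ =>
        Submodule.le_topologicalClosure _ (Submodule.subset_span ?_))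
    exact Set.mem_iUnion.2 ⟨i, x, rfl⟩
  · rw [Submodule.orthogonal_closure, Submodule.mem_orthogonal]
    intro u hu
    induction hu using Submodule.span_induction with
    | mem s hs =>
      obtain ⟨i, z, rfl⟩ := Set.mem_iUnion.1 hs
      rw [proj_symm, map_sub, (p i : K →L[ℂ] K).map_tsum (hsum x),
        tsum_eq_single i fun j hj => hpp i j hj.symm x, proj_idem, sub_self, inner_zero_right]
    | zero => simp
    | add a b _ _ ha hb => rw [inner_add_left, ha, hb, add_zero]
    | smul c a _ ha => rw [inner_smul_left, ha, mul_zero]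

/-! ### Orthonormal sequences with non-summable coefficients. -/

theorem exists_orthonormal_nat (hK : ¬ FiniteDimensional ℂ K) :
    ∃ y : ℕ → K, Orthonormal ℂ y := by
  obtain ⟨w, b, -⟩ := exists_hilbertBasis ℂ K
  have := infinite_of_hilbertBasis hK b
  exact ⟨b ∘ Infinite.natEmbedding w, b.orthonormal.comp _ (Infinite.natEmbedding w).injective⟩

theorem exists_orthonormal_not_summable_inner (hK : ¬ FiniteDimensional ℂ K) {v : K}
    (hv : v ≠ 0) : ∃ x : ℕ → K, Orthonormal ℂ x ∧ ¬ Summable fun i => ‖inner ℂ (x i) v‖ := by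
  obtain ⟨y, hy⟩ := exists_orthonormal_nat hK
  -- The coefficients `1 / (i + 1)` are square summable but not summable. The vector they define is
  -- then carried to a multiple of `v` by a unitary, and the orthonormal sequence moves along with
  -- it.
  have hsum : Summable fun i : ℕ => ((1 / ((i : ℝ) + 1) : ℝ) : ℂ) • y i := by
    refine (hy.orthogonalFamily.summable_iff_norm_sq_summable
      fun i : ℕ => ((1 / ((i : ℝ) + 1) : ℝ) : ℂ)).2 ?_
    have h := (summable_nat_add_iff 1).2 (Real.summable_one_div_nat_pow.2 (one_lt_two))
    refine h.congr fun i => ?_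
    rw [Complex.norm_real, Real.norm_eq_abs, sq_abs, div_pow, one_pow]
    push_cast
    rfl
  set w := ∑' i : ℕ, ((1 / ((i : ℝ) + 1) : ℝ) : ℂ) • y i with hw
  have hin : ∀ j, inner ℂ (y j) w = ((1 / ((j : ℝ) + 1) : ℝ) : ℂ) := by
    intro j
    have h : inner ℂ (y j) w = ∑' i : ℕ, inner ℂ (y j) (((1 / ((i : ℝ) + 1) : ℝ) : ℂ) • y i) :=
      (innerSL ℂ (y j)).map_tsum hsum
    rw [h, tsum_eq_single j]
    · rw [inner_smul_right, inner_self_eq_norm_sq_to_K, hy.1 j]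
      simp
    · intro i hij
      rw [inner_smul_right, hy.2 hij.symm, mul_zero]
  have hw0 : w ≠ 0 := by
    intro h
    have := hin 0
    rw [h] at this
    simp at this
  obtain ⟨U, c, hc, hU⟩ := exists_linearIsometryEquiv_apply_eq_smul hv hw0
  refine ⟨fun i => U (y i), hy.comp_linearIsometryEquiv U, fun hs => ?_⟩
  refine mt (summable_nat_add_iff 1).1 Real.not_summable_one_div_natCast ?_
  refine (hs.mul_left ‖c‖).congr fun i => ?_
  have h1 : c * inner ℂ (U (y i)) v = ((1 / ((i : ℝ) + 1) : ℝ) : ℂ) := by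
    rw [← inner_smul_right, ← hU, U.inner_map_map, hin]
  rw [← norm_mul, h1, Complex.norm_real, Real.norm_of_nonneg (by positivity)]
  push_cast
  rfl

theorem IsDensityOperator.ne_zero {ρ : K →L[ℂ] K} (hρ : IsDensityOperator ρ) : ρ ≠ 0 := by
  rintro rfl
  have h := hρ.hasSum_one
  simp only [_root_.zero_apply, inner_zero_right] at h
  exact zero_ne_one (hasSum_zero.unique h)

end Hilbert

/-! ### The divergent two-time series. -/

section Orthonormal

variable {H : Type*} [NormedAddCommGroup H] [InnerProductSpace ℂ H] {ι : Type*} {ψ : ι → H}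
  {i₁ : ι}

open Classical in
theorem inner_tprod_orthonormal (hψ : Orthonormal ℂ ψ) (i j k l : ι) :
    inner ℂ (tprod ![ψ i, ψ j]) (tprod ![ψ k, ψ l]) = if i = k ∧ j = l then (1 : ℂ) else 0 := by
  rw [inner_tprod, Fin.prod_univ_two]
  simp only [Matrix.cons_val_zero, Matrix.cons_val_one, orthonormal_iff_ite.1 hψ]
  by_cases h1 : i = k <;> by_cases h2 : j = l <;> simp [h1, h2]

theorem norm_tprod_orthonormal (hψ : Orthonormal ℂ ψ) (i j : ι) :
    ‖tprod ![ψ i, ψ j]‖ = 1 := by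
  have h : inner ℂ (tprod ![ψ i, ψ j]) (tprod ![ψ i, ψ j]) = (1 : ℂ) := by
    rw [inner_tprod_orthonormal hψ, if_pos ⟨rfl, rfl⟩]
  rw [inner_self_eq_norm_sq_to_K, RCLike.ofReal_eq_complex_ofReal] at h
  have h' : ‖tprod ![ψ i, ψ j]‖ ^ 2 = 1 := by exact_mod_cast h
  exact (pow_eq_one_iff_of_nonneg (norm_nonneg _) two_ne_zero).1 h'

theorem inner_symVec_symVec (hψ : Orthonormal ℂ ψ) {i j : ι} (hi : i ≠ i₁) (hij : i ≠ j) :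
    inner ℂ (symVec ψ i₁ i) (symVec ψ i₁ j) = 0 := by
  simp [symVec, inner_smul_left, inner_smul_right, inner_add_left, inner_add_right,
    inner_tprod_orthonormal hψ, hi, hij]

theorem projSpan_symVec_diag (hψ : Orthonormal ℂ ψ) :
    (projSpan (symVec ψ i₁ '' {i | i ≠ i₁}) : HistorySpace H 2 →L[ℂ] HistorySpace H 2)
      (tprod ![ψ i₁, ψ i₁]) = 0 := by
  refine projSpan_apply_eq (Submodule.zero_mem _) ?_
  rintro _ ⟨k, hk, rfl⟩
  have hk' : k ≠ i₁ := hk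
  simp [symVec, inner_tprod_orthonormal hψ, hk']

/-- Split `ψ i₁ ⊗ ψ i` into its symmetric and antisymmetric halves: the first is a multiple of `φ
i`, the second is orthogonal to every `φ k`. -/
theorem projSpan_symVec_offDiag (hψ : Orthonormal ℂ ψ) {i : ι} (hi : i ≠ i₁) :
    (projSpan (symVec ψ i₁ '' {i | i ≠ i₁}) : HistorySpace H 2 →L[ℂ] HistorySpace H 2)
      (tprod ![ψ i₁, ψ i]) = (2⁻¹ : ℂ) • (tprod ![ψ i, ψ i₁] + tprod ![ψ i₁, ψ i]) := by
  refine projSpan_apply_eq ?_ ?_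
  · have h2 : (Real.sqrt 2 : ℂ) ≠ 0 := by simp
    have e : (2⁻¹ : ℂ) • (tprod ![ψ i, ψ i₁] + tprod ![ψ i₁, ψ i])
        = (2⁻¹ * (Real.sqrt 2 : ℂ)) • symVec ψ i₁ i := by
      rw [symVec, smul_smul, mul_assoc, mul_inv_cancel₀ h2, mul_one]
    rw [e]
    exact Submodule.smul_mem _ _ (Submodule.subset_span ⟨i, hi, rfl⟩)
  · rintro _ ⟨k, hk, rfl⟩
    have hk' : k ≠ i₁ := hk
    by_cases hki : k = i
    · subst hki
      simp [symVec, inner_tprod_orthonormal hψ, norm_tprod_orthonormal hψ, hk', hk'.symm]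
      ring
    · simp [symVec, inner_tprod_orthonormal hψ, hk', hki, hi.symm]

open Classical in
-- The factor with `q` vanishes unless `j₁ = j₂ = j₃ = i₁`. The other factor is then the coefficient
-- `1/2` of the swapped tensor, except at `j₄ = i₁`, where the projection kills `ψ i₁ ⊗ ψ i₁`.
theorem ilsTerm_symVec (hψ : Orthonormal ℂ ψ) (ω : ι → ℝ) (j : ι × ι × ι × ι) :
    ilsTerm ω ψ ψ ψ ψ (projSpan (symVec ψ i₁ '' {i | i ≠ i₁}))
        (projSpan {tprod ![ψ i₁, ψ i₁]}) j
      = if (j.1 = i₁ ∧ j.2.1 = i₁ ∧ j.2.2.1 = i₁) ∧ j.2.2.2 ≠ i₁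
        then ((ω i₁ / 2 : ℝ) : ℂ) else 0 := by
  obtain ⟨j₁, j₂, j₃, j₄⟩ := j
  simp only [ilsTerm, projSpan_singleton_apply (norm_tprod_orthonormal hψ _ _), inner_smul_right,
    inner_tprod_orthonormal hψ]
  by_cases hj : j₁ = i₁ ∧ j₂ = i₁ ∧ j₃ = i₁
  · obtain ⟨rfl, rfl, rfl⟩ := hj
    by_cases h4 : j₄ = j₃
    · subst h4
      simp [projSpan_symVec_diag hψ]
    · rw [projSpan_symVec_offDiag hψ h4]
      simp [inner_smul_right, inner_add_right, inner_tprod_orthonormal hψ,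
        norm_tprod_orthonormal hψ, h4, div_eq_mul_inv]
  · rw [if_neg fun h : (j₁ = i₁ ∧ j₂ = i₁ ∧ j₃ = i₁) ∧ j₄ ≠ i₁ => hj h.1]
    by_cases h1 : i₁ = j₂ ∧ i₁ = j₃
    · have h2 : ¬ (j₁ = i₁ ∧ j₂ = i₁) := fun h => hj ⟨h.1, h.2, h1.2.symm⟩
      rw [if_neg h2, mul_zero, mul_zero, mul_zero]
    · rw [if_neg h1, zero_mul, mul_zero, mul_zero]

theorem tendsto_sum_re_ilsTerm [Infinite ι] (hψ : Orthonormal ℂ ψ) {ω : ι → ℝ}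
    (hω : 0 < ω i₁) :
    Tendsto (fun s : Finset (ι × ι × ι × ι) =>
      (∑ j ∈ s, ilsTerm ω ψ ψ ψ ψ (projSpan (symVec ψ i₁ '' {i | i ≠ i₁}))
        (projSpan {tprod ![ψ i₁, ψ i₁]}) j).re) atTop atTop := by
  classical
  refine tendsto_atTop.2 fun B => ?_
  -- All terms are nonnegative, so containing `N` of the indices with value `ω i₁ / 2` already
  -- pushes a partial sum past `B`.
  obtain ⟨N, hN⟩ := exists_nat_ge (B / (ω i₁ / 2))
  obtain ⟨T, hT, hcard⟩ := ((Set.finite_singleton i₁).infinite_compl).exists_subset_card_eq N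
  have hinj : Function.Injective fun i : ι => (i₁, i₁, i₁, i) := fun a b h => by simpa using h
  filter_upwards [eventually_ge_atTop (T.image fun i => (i₁, i₁, i₁, i))] with s hs
  simp only [ilsTerm_symVec hψ, Complex.re_sum]
  calc B ≤ N * (ω i₁ / 2) := (div_le_iff₀ (by positivity)).1 hN
    _ = ∑ i ∈ T, ω i₁ / 2 := by rw [Finset.sum_const, hcard, nsmul_eq_mul]
    _ = ∑ j ∈ T.image fun i => (i₁, i₁, i₁, i), (if (j.1 = i₁ ∧ j.2.1 = i₁ ∧ j.2.2.1 = i₁) ∧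
          j.2.2.2 ≠ i₁ then ((ω i₁ / 2 : ℝ) : ℂ) else 0).re := by
        rw [Finset.sum_image fun a _ b _ h => hinj h]
        refine Finset.sum_congr rfl fun i hi => ?_
        have hi' : i ≠ i₁ := hT hi
        rw [if_pos ⟨⟨rfl, rfl, rfl⟩, hi'⟩, Complex.ofReal_re]
    _ ≤ _ := by
        refine Finset.sum_le_sum_of_subset_of_nonneg hs fun j _ _ => ?_
        split_ifs
        · rw [Complex.ofReal_re]
          positivity
        · simp

end Orthonormal

/-! ### Two-step histories and the failure of countable additivity. -/

section Decoherence

variable {H : Type*} [NormedAddCommGroup H] [InnerProductSpace ℂ H] [CompleteSpace H]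

/-- A pure tensor with one zero factor vanishes; linearity and density carry this to the whole
completion. -/
theorem homogeneous_mul_eq_zero {n : ℕ} (h k : Fin n → Proj H) (i : Fin n)
    (hi : (h i : H →L[ℂ] H) * (k i : H →L[ℂ] H) = 0) :
    (homogeneous h : HistorySpace H n →L[ℂ] HistorySpace H n)
      * (homogeneous k : HistorySpace H n →L[ℂ] HistorySpace H n) = 0 := by
  refine ContinuousLinearMap.ext fun x => ?_
  change tensorOp h (tensorOp k x) = 0
  induction x using UniformSpace.Completion.induction_on with
  | hp => exact isClosed_eq (by fun_prop) (by fun_prop)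
  | ih a =>
    rw [tensorOp_coe, tensorOp_coe]
    suffices e : algProj h (algProj k a) = 0 by rw [e, UniformSpace.Completion.coe_zero]
    induction a using algTensor_induction with
    | tp c x =>
      simp only [algProj, map_smul, algMap_tprod, ContinuousLinearMap.coe_coe]
      rw [MultilinearMap.map_coord_zero algTprod i
        (congrArg (fun f : H →L[ℂ] H => f (x i)) hi), smul_zero]
    | add a b ha hb => simp only [map_add, ha, hb, add_zero]

/-- The identity as a projection. -/
noncomputable def oneProj (H : Type*) [NormedAddCommGroup H] [InnerProductSpace ℂ H]
    [CompleteSpace H] : Proj H :=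
  ⟨1, IsStarProjection.one _⟩

/-- The history that tests for `x` first, then for `b`, and then for nothing. -/
noncomputable def twoStep {m : ℕ} (x b : H) : Fin (m + 2) → Proj H :=
  Fin.cons (projSpan {x}) (Fin.cons (projSpan {b}) fun _ => oneProj H)

theorem stdDecoherence_twoStep {ρ : H →L[ℂ] H} (hρ : IsSelfAdjoint ρ) {m : ℕ} {x b : H}
    (hx : ‖x‖ = 1) (hb : ‖b‖ = 1) :
    stdDecoherence ρ (twoStep (m := m) x b) (fun _ => oneProj H)
      = inner ℂ b x * inner ℂ (ρ x) b := by
  have e : (List.ofFn fun i => (twoStep (m := m) x b i : H →L[ℂ] H)).reverse.prod * ρ *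
      (List.ofFn fun _ : Fin (m + 2) => (oneProj H : H →L[ℂ] H)).prod
      = (projSpan {b} : H →L[ℂ] H) * (projSpan {x} : H →L[ℂ] H) * ρ := by
    simp [List.ofFn_succ, twoStep, oneProj, mul_assoc]
  -- Parseval's identity for `⟪ρ x, b⟫` in the basis that defines the trace matches the two series
  -- term by term, so basis independence of the trace is never used.
  rw [stdDecoherence, e, trace, ← (stdBasis H).tsum_inner_mul_inner (ρ x) b, ← tsum_mul_left]
  refine tsum_congr fun i => ?_
  have e2 : inner ℂ (ρ x) (stdBasis H i) = inner ℂ x (ρ (stdBasis H i)) :=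
    ContinuousLinearMap.isSelfAdjoint_iff_isSymmetric.1 hρ _ _
  rw [e2]
  simp only [mul_apply_eq_comp, projSpan_singleton_apply hx,
    projSpan_singleton_apply hb, inner_smul_right]
  ring

theorem not_exists_countablyAdditive_extension (hH : ¬ FiniteDimensional ℂ H) {ρ : H →L[ℂ] H}
    (hρ : IsDensityOperator ρ) {n : ℕ} (hn : 2 ≤ n) :
    ¬ ∃ D : Proj (HistorySpace H n) → Proj (HistorySpace H n) → ℂ,
      ExtendsStd ρ D ∧ IsCountablyAdditive D := by
  rintro ⟨D, hD, hadd⟩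
  obtain ⟨m, rfl⟩ := Nat.exists_eq_add_of_le' hn
  obtain ⟨u, hu⟩ : ∃ u, ρ u ≠ 0 := by
    by_contra! h
    exact hρ.ne_zero (ContinuousLinearMap.ext h)
  obtain ⟨x, hx, hns⟩ := exists_orthonormal_not_summable_inner hH hu
  choose b hb hle using fun i => exists_unit_norm_le hρ.isPositive (hx.1 i)
  have horth : Pairwise fun i j =>
      (homogeneous (twoStep (m := m) (x i) (b i)) : HistorySpace H (m + 2) →L[ℂ] HistorySpace H (m + 2))
        * (homogeneous (twoStep (m := m) (x j) (b j)) :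
          HistorySpace H (m + 2) →L[ℂ] HistorySpace H (m + 2)) = 0 := by
    intro i j hij
    refine homogeneous_mul_eq_zero _ _ 0 (ContinuousLinearMap.ext fun z => ?_)
    simp [twoStep, projSpan_singleton_apply (hx.1 _), hx.2 hij]
  obtain ⟨P, hP⟩ := exists_isOrthogonalSum
    (fun i => homogeneous (twoStep (m := m) (x i) (b i))) horth
  -- Summability in `ℂ` is absolute, so the moduli can be compared with `‖ρ (x i)‖ / 2`.
  have hs := (hadd _ P (homogeneous fun _ => oneProj H) hP).summable.norm
  simp only [hD _ _, stdDecoherence_twoStep hρ.isPositive.isSelfAdjoint (hx.1 _) (hb _)] at hs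
  refine hns (Summable.of_nonneg_of_le (fun i => norm_nonneg _) (fun i => ?_)
    (hs.mul_left (2 * ‖u‖)))
  have e : inner ℂ (x i) (ρ u) = inner ℂ (ρ (x i)) u :=
    (ContinuousLinearMap.isSelfAdjoint_iff_isSymmetric.1 hρ.isPositive.isSelfAdjoint _ _).symm
  calc ‖inner ℂ (x i) (ρ u)‖ ≤ ‖ρ (x i)‖ * ‖u‖ := by
        rw [e]
        exact norm_inner_le_norm _ _
    _ = 2 * ‖u‖ * (‖ρ (x i)‖ / 2) := by ring
    _ ≤ _ := mul_le_mul_of_nonneg_left (hle i) (by positivity)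

end Decoherence

end HistoryQM

theorem mainTheorem5 {H : Type*} [NormedAddCommGroup H] [InnerProductSpace ℂ H] [CompleteSpace H]
    (hH : ¬ FiniteDimensional ℂ H) (ρ : H →L[ℂ] H) (hρ : HistoryQM.IsDensityOperator ρ) :
    (∀ n : ℕ, 2 ≤ n →
      ¬ ∃ D : HistoryQM.Proj (HistoryQM.HistorySpace H n) →
            HistoryQM.Proj (HistoryQM.HistorySpace H n) → ℂ,
          HistoryQM.ExtendsStd ρ D ∧ HistoryQM.IsCountablyAdditive D) ∧
    (∀ (ι : Type*) (ψ : HilbertBasis ι ℂ H) (ω : ι → ℝ),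
      (∀ i, ρ (ψ i) = (ω i : ℂ) • ψ i) →
      ∀ i₁ : ι, ω i₁ ≠ 0 →
        Pairwise (fun i j : {i : ι // i ≠ i₁} =>
          inner ℂ (HistoryQM.symVec ψ i₁ i) (HistoryQM.symVec ψ i₁ j) = 0) ∧
        ∃ q : HistoryQM.Proj (HistoryQM.HistorySpace H 2),
          Filter.Tendsto
            (fun s : Finset (ι × ι × ι × ι) =>
              (∑ j ∈ s, HistoryQM.ilsTerm ω ψ ψ ψ ψ
                (HistoryQM.projSpan (HistoryQM.symVec ψ i₁ '' {i | i ≠ i₁})) q j).re)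
            Filter.atTop Filter.atTop) := by
  refine ⟨fun n hn => HistoryQM.not_exists_countablyAdditive_extension hH hρ hn, ?_⟩
  intro ι ψ ω hω i₁ hi₁
  have := HistoryQM.infinite_of_hilbertBasis hH ψ
  refine ⟨fun i j hij => HistoryQM.inner_symVec_symVec ψ.orthonormal i.2
    fun h => hij (Subtype.ext h), _, HistoryQM.tendsto_sum_re_ilsTerm ψ.orthonormal ?_⟩
  exact HistoryQM.eigenvalue_pos hρ.isPositive (ψ.orthonormal.1 i₁) (hω i₁) hi₁
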